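/- For $\lambda\in\mathbb{C}$ let $f_\lambda(z)=\lambda+z+\tan z$, a meromorphic function $\mathbb{C}\to\widehat{\mathbb{C}}=\mathbb{C}\cup\{\infty\}$ with essential singularity at $\infty$. Its Fatou set $\mathcal F(f_\lambda)\subset\mathbb{C}$ is the set of all points having an open neighbourhood on which all iterates $f_\lambda^n$ ($n>0$) are defined and form a normal family with respect to the spherical metric. A Fatou component is a connected component of $\mathcal F(f_\lambda)$; for such a component $U$ and $n\ge 0$, $U_n$ denotes the Fatou component containing $f_\lambda^n(U)$. The component $U$ is $p$-periodic if $p$ is the smallest positive integer with $U_p=U$, invariant if it is $1$-periodic, and completely invariant if it is invariant and $f_\lambda^{-1}(U)\subseteq U$. A $p$-periodic Fatou component $U$ is a Baker domain if for some $k$ the iterates $f_\lambda^{np}$ tend to $\infty$ as $n\to\infty$, uniformly on every compact subset of $U_k$. **Theorem.** (1) For every $\lambda\in\mathbb{C}$ with $\Im(\lambda)>0$ there is a completely invariant Baker domain $B_\lambda$ of $f_\lambda$ that contains the upper half plane $\{z:\Im(z)>0\}$. (It is called the primary Fatou component of $f_\lambda$.) (2) For every real $\lambda$, the upper half plane $\{z:\Im(z)>0\}$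 and the lower half plane $\{z:\Im(z)<0\}$ are completely invariant Baker domains of $f_\lambda$, and $\mathcal F(f_\lambda)$ is the union of these two half planes. -/

import Mathlib

open Filter Topology Set

noncomputable section

namespace MeroDynamics

/-!
Dynamics of a transcendental meromorphic function `f : ℂ → ℂ ∪ {∞}` whose only essential
singularity is at `∞`. The Riemann sphere is `OnePoint ℂ`.
-/

/-- The uniform structure of the Riemann sphere. The sphere is compact Hausdorff, so this is the
only uniform structure that induces its topology, namely that of the chordal (or spherical)
metric. -/
instance sphereUniformSpace : UniformSpace (OnePoint ℂ) := uniformSpaceOfCompactR1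

/-- The `n`-th iterate of `f`. The function `f` is not defined at `∞`, so `f^n` is really defined
at `z` only if `f^k z ≠ ∞` for all `k < n`; elsewhere `∞` is used as a placeholder value (see
`DefinedOn`). -/
def iter (f : ℂ → OnePoint ℂ) (n : ℕ) (z : ℂ) : OnePoint ℂ :=
  (fun w : OnePoint ℂ => w.elim OnePoint.infty f)^[n] (z : OnePoint ℂ)

/-- The iterate `f^n` is defined at every point of `U`. -/
def DefinedOn (f : ℂ → OnePoint ℂ) (n : ℕ) (U : Set ℂ) : Prop :=
  ∀ z ∈ U, ∀ k < n, iter f k z ≠ OnePoint.infty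

/-- A family of maps into the Riemann sphere is normal on an open set `U` if every sequence of
members of it has a subsequence that converges locally uniformly on `U` in the spherical
sense (the limit function may take the value `∞`). -/
def IsNormalFamilyOn {ι : Type*} (F : ι → ℂ → OnePoint ℂ) (U : Set ℂ) : Prop :=
  ∀ s : ℕ → ι, ∃ φ : ℕ → ℕ, StrictMono φ ∧ ∃ g : ℂ → OnePoint ℂ,
    TendstoLocallyUniformlyOn (fun j => F (s (φ j))) g atTop U

/-- The Fatou set: all points with an open neighbourhood on which all iterates `f^n`, `n > 0`, are
defined and form a normal family. The essential singularity `∞` never belongs to it, so it is a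
set of complex numbers. -/
def fatouSet (f : ℂ → OnePoint ℂ) : Set ℂ :=
  {z | ∃ U : Set ℂ, IsOpen U ∧ z ∈ U ∧ (∀ n, DefinedOn f n U) ∧
    IsNormalFamilyOn (fun n : {n : ℕ // 0 < n} => iter f n) U}

/-- Fatou components: the connected components of the Fatou set. -/
def IsFatouComponent (f : ℂ → OnePoint ℂ) (U : Set ℂ) : Prop :=
  ∃ z ∈ fatouSet f, U = connectedComponentIn (fatouSet f) z

/-- `W` is the component `U_n`, that is, the Fatou component that contains `f^n(U)`. -/
def IsImageComponent (f : ℂ → OnePoint ℂ) (U : Set ℂ) (n : ℕ) (W : Set ℂ) : Prop :=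
  IsFatouComponent f W ∧ iter f n '' U ⊆ (fun w : ℂ => (w : OnePoint ℂ)) '' W

/-- `U` is a `p`-periodic Fatou component: `p` is the smallest positive integer with `U_p = U`. -/
def IsPeriodicComponent (f : ℂ → OnePoint ℂ) (U : Set ℂ) (p : ℕ) : Prop :=
  IsFatouComponent f U ∧ IsLeast {n : ℕ | 0 < n ∧ IsImageComponent f U n U} p

/-- `U` is an invariant Fatou component with `f⁻¹(U) ⊆ U`. -/
def IsCompletelyInvariantComponent (f : ℂ → OnePoint ℂ) (U : Set ℂ) : Prop :=
  IsPeriodicComponent f U 1 ∧ f ⁻¹' ((fun w : ℂ => (w : OnePoint ℂ)) '' U) ⊆ U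

/-- `U` is a Baker domain: a periodic Fatou component, of period `p` say, such that for some
`k` the iterates `f^{np}` tend to `∞` uniformly on every compact subset of `U_k`. -/
def IsBakerDomain (f : ℂ → OnePoint ℂ) (U : Set ℂ) : Prop :=
  ∃ p : ℕ, IsPeriodicComponent f U p ∧ ∃ (k : ℕ) (W : Set ℂ), IsImageComponent f U k W ∧
    ∀ K : Set ℂ, IsCompact K → K ⊆ W →
      TendstoUniformlyOn (fun n => iter f (n * p)) (fun _ => OnePoint.infty) atTop K

open Classical in
/-- The meromorphic function `f_c(z) = c + z + tan z`, with value `∞` at the poles, which are the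
zeros of the cosine. -/
def tanMap (c z : ℂ) : OnePoint ℂ :=
  if Complex.cos z = 0 then OnePoint.infty else ((c + z + Complex.tan z : ℂ) : OnePoint ℂ)

end MeroDynamics

end

/-!
Write `f = tanMap c`. The identity `im (tan z) = sinh y cosh y / (cos² x + sinh² y)` for
`z = x + i y` shows that the tangent preserves both half planes and that `im (tan z) ≥ y / (1 + y)`
for `y > 0`. Hence, if `0 ≤ im c`, the imaginary part grows at least linearly along orbits in the
upper half plane, which therefore lies in the Fatou set and escapes to `∞` locally uniformly. The
lower half plane is treated simultaneously, with a sign `s = ± 1`.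

For `0 < im c` let `B` be the Fatou component containing the upper half plane.
* `f` maps `B` into `B`, since `f` preserves the Fatou set and `B` is connected.
* All preimages of `B` lie in `B` (`mem_component_of_tanVal_mem`). Large points with values in a
  fixed disc lie near poles, and vertical lines halfway between the poles separate them, so the
  components of the preimage of a disc are bounded
  (`isBounded_of_isPreconnected_of_tanVal_mem_ball`). Thus `f` is proper on such a component and
  maps it onto the disc (`ball_subset_image_connectedComponentIn`). Consequently the set of points of
  `B` all of whose preimages lie in `B` is relatively open and closed in `B`. It contains `2 c`,
  because points with `im z ≤ 0` have images with imaginary part at most `im c`.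
* All of `B` escapes (`escapesAt_of_mem_component`): a spherical limit function `g` of iterates that
  equals `∞` on an open set has a reciprocal that is holomorphic near the boundary points of that
  set, so the identity theorem extends `g = ∞` (`eventually_eq_infty_of_mem_closure`).

For real `c` both half planes are invariant together with their preimages. The real axis is disjoint
from the Fatou set (`ofReal_notMem_fatouSet`), because `f` maps it to itself with derivative
`1 + 1 / cos² ≥ 2`, so that the iterates of any interval grow until they cover a pole.
-/

namespace MeroDynamics

/-! ### The tangent function off the real line -/

lemma normSq_sin_eq (z : ℂ) :
    Complex.normSq (Complex.sin z) = Real.sin z.re ^ 2 + Real.sinh z.im ^ 2 := by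
  have h1 := Real.sin_sq_add_cos_sq z.re
  have h2 := Real.cosh_sq z.im
  rw [Complex.normSq_apply, Complex.sin_eq z]
  simp only [← Complex.ofReal_sin, ← Complex.ofReal_cos, ← Complex.ofReal_sinh,
    ← Complex.ofReal_cosh, Complex.add_re, Complex.add_im, Complex.mul_re, Complex.mul_im,
    Complex.ofReal_re, Complex.ofReal_im, Complex.I_re, Complex.I_im]
  linear_combination (Real.sin z.re ^ 2) * h2 + Real.sinh z.im ^ 2 * h1

lemma normSq_cos_eq (z : ℂ) :
    Complex.normSq (Complex.cos z) = Real.cos z.re ^ 2 + Real.sinh z.im ^ 2 := by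
  have h1 := Real.sin_sq_add_cos_sq z.re
  have h2 := Real.cosh_sq z.im
  rw [Complex.normSq_apply, Complex.cos_eq z]
  simp only [← Complex.ofReal_sin, ← Complex.ofReal_cos, ← Complex.ofReal_sinh,
    ← Complex.ofReal_cosh, Complex.sub_re, Complex.sub_im, Complex.mul_re, Complex.mul_im,
    Complex.ofReal_re, Complex.ofReal_im, Complex.I_re, Complex.I_im]
  linear_combination (Real.cos z.re ^ 2) * h2 + Real.sinh z.im ^ 2 * h1

lemma tan_im_eq (z : ℂ) :
    (Complex.tan z).im =
      Real.sinh z.im * Real.cosh z.im / (Real.cos z.re ^ 2 + Real.sinh z.im ^ 2) := by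
  have h1 := Real.sin_sq_add_cos_sq z.re
  rw [Complex.tan, Complex.div_im, normSq_cos_eq, ← sub_div]
  congr 1
  rw [Complex.sin_eq z, Complex.cos_eq z]
  simp only [← Complex.ofReal_sin, ← Complex.ofReal_cos, ← Complex.ofReal_sinh,
    ← Complex.ofReal_cosh, Complex.sub_re, Complex.sub_im, Complex.add_re, Complex.add_im,
    Complex.mul_re, Complex.mul_im,
    Complex.ofReal_re, Complex.ofReal_im, Complex.I_re, Complex.I_im]
  linear_combination (Real.cosh z.im * Real.sinh z.im) * h1

lemma cos_ne_zero_of_im_ne_zero {z : ℂ} (hz : z.im ≠ 0) : Complex.cos z ≠ 0 := by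
  rw [← Complex.normSq_pos, normSq_cos_eq]
  have : Real.sinh z.im ≠ 0 := by simpa [Real.sinh_eq_zero] using hz
  positivity

lemma div_one_add_self_le_tan_im {z : ℂ} (hz : 0 < z.im) :
    z.im / (1 + z.im) ≤ (Complex.tan z).im := by
  rw [tan_im_eq]
  have hs : 0 < Real.sinh z.im := Real.sinh_pos_iff.2 hz
  have hc : 0 < Real.cosh z.im := Real.cosh_pos _
  have h2 := Real.cosh_sq z.im
  have h3 := Real.cos_sq_le_one z.re
  have h1 : Real.cosh z.im ≤ Real.sinh z.im * (1 + 1 / z.im) := by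
    have e : Real.cosh z.im = Real.sinh z.im + Real.exp (-z.im) := by
      rw [Real.cosh_eq, Real.sinh_eq]; ring
    have h4 : Real.exp (-z.im) ≤ 1 := Real.exp_le_one_iff.2 (by linarith)
    have h5 : z.im ≤ Real.sinh z.im := Real.self_le_sinh_iff.2 hz.le
    have h6 : 1 ≤ Real.sinh z.im * (1 / z.im) := by
      rw [mul_one_div, le_div_iff₀ hz]; linarith
    linarith
  calc z.im / (1 + z.im) ≤ Real.sinh z.im / Real.cosh z.im := by
        rw [div_le_div_iff₀ (by positivity) hc]
        calc z.im * Real.cosh z.im ≤ z.im * (Real.sinh z.im * (1 + 1 / z.im)) := by gcongr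
          _ = _ := by field_simp; ring
    _ = Real.sinh z.im * Real.cosh z.im / (1 + Real.sinh z.im ^ 2) := by
        rw [add_comm, ← h2]; field_simp
    _ ≤ _ := by gcongr

lemma tan_im_nonpos {z : ℂ} (hz : z.im ≤ 0) : (Complex.tan z).im ≤ 0 := by
  rw [tan_im_eq]
  have hs : Real.sinh z.im ≤ 0 := Real.sinh_nonpos_iff.2 hz
  have hc : 0 < Real.cosh z.im := Real.cosh_pos _
  exact div_nonpos_of_nonpos_of_nonneg (mul_nonpos_of_nonpos_of_nonneg hs hc.le) (by positivity)

lemma norm_tan_le_two {z : ℂ} (hz : 1 ≤ |z.im|) : ‖Complex.tan z‖ ≤ 2 := by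
  have h0 : z.im ≠ 0 := by rintro h; norm_num [h] at hz
  have hc := norm_pos_iff.2 (cos_ne_zero_of_im_ne_zero h0)
  rw [Complex.tan, norm_div, div_le_iff₀ hc]
  refine le_of_sq_le_sq ?_ (by positivity)
  have hs : 1 ≤ Real.sinh z.im ^ 2 := by
    rw [← sq_abs, Real.abs_sinh]
    have := Real.self_le_sinh_iff.2 (abs_nonneg z.im)
    nlinarith
  rw [mul_pow, ← Complex.normSq_eq_norm_sq, ← Complex.normSq_eq_norm_sq, normSq_sin_eq,
    normSq_cos_eq]
  nlinarith [Real.sin_sq_le_one z.re, sq_nonneg (Real.cos z.re)]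

lemma norm_tan_le_one_of_sin_re_eq_zero {z : ℂ} (hz : Real.sin z.re = 0) :
    ‖Complex.tan z‖ ≤ 1 := by
  have h1 := Real.sin_sq_add_cos_sq z.re
  have h : Real.cos z.re ^ 2 = 1 := by rw [hz] at h1; linarith
  have hc : 0 < ‖Complex.cos z‖ := by
    rw [norm_pos_iff, ← Complex.normSq_pos, normSq_cos_eq, h]; positivity
  rw [Complex.tan, norm_div, div_le_iff₀ hc, one_mul]
  refine le_of_sq_le_sq ?_ (by positivity)
  rw [← Complex.normSq_eq_norm_sq, ← Complex.normSq_eq_norm_sq, normSq_sin_eq, normSq_cos_eq, hz, h]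
  linarith

/-! ### The finite values of the map and its iterates -/

/-- The complex-valued expression `c + z + tan z`. At the poles of the tangent its value
has no meaning, and it is used only where `cos z ≠ 0`. -/
noncomputable def tanVal (c z : ℂ) : ℂ := c + z + Complex.tan z

lemma tanMap_of_cos_ne_zero {c z : ℂ} (h : Complex.cos z ≠ 0) :
    tanMap c z = (tanVal c z : OnePoint ℂ) := by
  simp [tanMap, h, tanVal]

lemma tanMap_ne_infty_iff {c z : ℂ} : tanMap c z ≠ OnePoint.infty ↔ Complex.cos z ≠ 0 := by
  by_cases h : Complex.cos z = 0
  · simp [tanMap, h]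
  · simp [tanMap, h]

lemma tanMap_eq_coe_iff {c z w : ℂ} :
    tanMap c z = (w : OnePoint ℂ) ↔ Complex.cos z ≠ 0 ∧ tanVal c z = w := by
  by_cases h : Complex.cos z = 0
  · simp [tanMap, h]
  · simp [tanMap, h, tanVal]

lemma isOpen_cos_ne_zero : IsOpen {z : ℂ | Complex.cos z ≠ 0} :=
  isOpen_ne_fun Complex.continuous_cos continuous_const

lemma differentiableAt_tanVal (c : ℂ) {z : ℂ} (h : Complex.cos z ≠ 0) :
    DifferentiableAt ℂ (tanVal c) z :=
  ((differentiableAt_const c).add differentiableAt_id).add (Complex.differentiableAt_tan.2 h)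

lemma analyticAt_tanVal (c : ℂ) {z : ℂ} (h : Complex.cos z ≠ 0) : AnalyticAt ℂ (tanVal c) z :=
  DifferentiableOn.analyticAt (s := {z | Complex.cos z ≠ 0})
    (fun _ hw => (differentiableAt_tanVal c hw).differentiableWithinAt)
    (isOpen_cos_ne_zero.mem_nhds h)

lemma not_eventually_tanVal_const (c w : ℂ) {z₀ : ℂ} (h : Complex.cos z₀ ≠ 0) :
    ¬ ∀ᶠ z in 𝓝 z₀, tanVal c z = w := by
  intro hev
  -- Multiplied by the cosine, the equation `tanVal c z = w` is one between entire functions.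
  let F : ℂ → ℂ := fun z => (c + z - w) * Complex.cos z + Complex.sin z
  have hF : Differentiable ℂ F := by fun_prop
  have h0 : F =ᶠ[𝓝 z₀] 0 := by
    filter_upwards [hev, isOpen_cos_ne_zero.mem_nhds h] with z hz hc
    have hc : Complex.cos z ≠ 0 := hc
    have := Complex.tan_mul_cos hc
    simp only [tanVal] at hz
    simp only [F, Pi.zero_apply]
    linear_combination Complex.cos z * hz - this
  have hall : F = 0 :=
    AnalyticOnNhd.eq_of_eventuallyEq (fun z _ => hF.analyticAt z) (fun z _ => analyticAt_const) h0
  have h1 : F (w - c) = 0 := by rw [hall]; rfl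
  have h2 : F (w - c + Real.pi) = 0 := by rw [hall]; rfl
  simp only [F, Complex.sin_add_pi, Complex.cos_add_pi] at h1 h2
  have hs : Complex.sin (w - c) = 0 := by linear_combination h1
  have hp : (Real.pi : ℂ) ≠ 0 := by exact_mod_cast Real.pi_ne_zero
  have hc : Complex.cos (w - c) = 0 := by
    have : (Real.pi : ℂ) * Complex.cos (w - c) = 0 := by linear_combination -h2 - hs
    exact (mul_eq_zero.1 this).resolve_left hp
  have := Complex.sin_sq_add_cos_sq (w - c)
  simp [hs, hc] at this

/-- The map is open at its finite values. -/
lemma image_tanVal_mem_nhds (c : ℂ) {z : ℂ} (h : Complex.cos z ≠ 0) {s : Set ℂ} (hs : s ∈ 𝓝 z) :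
    tanVal c '' s ∈ 𝓝 (tanVal c z) := by
  rcases (analyticAt_tanVal c h).eventually_constant_or_nhds_le_map_nhds with h1 | h1
  · exact absurd h1 (not_eventually_tanVal_const c _ h)
  · exact h1 (image_mem_map hs)

lemma iter_succ_of_iter_eq {f : ℂ → OnePoint ℂ} {n : ℕ} {z w : ℂ}
    (h : iter f n z = (w : OnePoint ℂ)) : iter f (n + 1) z = f w := by
  unfold iter at *
  rw [Function.iterate_succ_apply', h]; rfl

lemma iter_succ_of_eq {f : ℂ → OnePoint ℂ} (n : ℕ) {z w : ℂ}
    (h : f z = (w : OnePoint ℂ)) : iter f (n + 1) z = iter f n w := by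
  unfold iter
  rw [Function.iterate_succ_apply]
  congr 1

/-! ### The Fatou set: invariance under the map and its inverse -/

lemma isOpen_fatouSet (f : ℂ → OnePoint ℂ) : IsOpen (fatouSet f) := by
  rw [isOpen_iff_mem_nhds]
  rintro z ⟨U, hU, hz, h⟩
  exact mem_of_superset (hU.mem_nhds hz) fun w hw => ⟨U, hU, hw, h⟩

lemma iter_ne_infty_of_mem_fatouSet {f : ℂ → OnePoint ℂ} {z : ℂ} (hz : z ∈ fatouSet f) (n : ℕ) :
    iter f n z ≠ OnePoint.infty := by
  obtain ⟨U, -, hzU, hdef, -⟩ := hz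
  exact hdef (n + 1) z hzU n n.lt_succ_self

/-- Local uniform convergence is preserved when the index runs through a subsequence. -/
lemma _root_.TendstoLocallyUniformlyOn.comp_tendsto {α β ι κ : Type*} [TopologicalSpace α]
    [UniformSpace β] {F : ι → α → β} {g : α → β} {p : Filter ι} {q : Filter κ} {s : Set α}
    (h : TendstoLocallyUniformlyOn F g p s) {φ : κ → ι} (hφ : Tendsto φ q p) :
    TendstoLocallyUniformlyOn (fun k => F (φ k)) g q s := by
  intro u hu x hx
  obtain ⟨t, ht, hev⟩ := h u hu x hx
  exact ⟨t, ht, hφ.eventually hev⟩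

lemma tendstoLocallyUniformlyOn_const_seq {α β ι : Type*} [TopologicalSpace α]
    [UniformSpace β] (g : α → β) (p : Filter ι) (s : Set α) :
    TendstoLocallyUniformlyOn (fun _ => g) g p s :=
  fun _ hu _ _ => ⟨univ, univ_mem, Eventually.of_forall fun _ _ _ => refl_mem_uniformity hu⟩

/-- A sequence of natural numbers either takes some value infinitely often or tends to infinity. -/
lemma tendsto_atTop_or_exists_frequently_eq (s : ℕ → ℕ) :
    Tendsto s atTop atTop ∨ ∃ v, ∃ᶠ j in atTop, s j = v := by
  by_contra! h
  refine h.1 (tendsto_atTop.2 fun b => ?_)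
  have h2 : ∀ᶠ j in atTop, ∀ v ∈ Finset.range b, s j ≠ v :=
    (Finset.eventually_all _).2 fun v _ => h.2 v
  filter_upwards [h2] with j hj
  by_contra! hlt
  exact hj _ (Finset.mem_range.2 hlt) rfl

/-- `f^n` tends to `∞` as `n → ∞`, uniformly near `z`. -/
def EscapesAt (f : ℂ → OnePoint ℂ) (z : ℂ) : Prop :=
  Tendsto (fun q : ℕ × ℂ => iter f q.1 q.2) (atTop ×ˢ 𝓝 z) (𝓝 OnePoint.infty)

lemma EscapesAt.tendsto {f : ℂ → OnePoint ℂ} {z : ℂ} (h : EscapesAt f z) :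
    Tendsto (fun n => iter f n z) atTop (𝓝 OnePoint.infty) :=
  Tendsto.comp h (tendsto_id.prodMk tendsto_const_pure |>.mono_right
    (prod_mono le_rfl (pure_le_nhds z)))

lemma tendstoLocallyUniformlyOn_infty {f : ℂ → OnePoint ℂ} {s : Set ℂ}
    (h : ∀ z ∈ s, EscapesAt f z) :
    TendstoLocallyUniformlyOn (fun n => iter f n) (fun _ => OnePoint.infty) atTop s := by
  rw [tendstoLocallyUniformlyOn_iff_forall_tendsto]
  intro z hz
  have h1 : Tendsto (fun q : ℕ × ℂ => iter f q.1 q.2) (atTop ×ˢ 𝓝[s] z) (𝓝 OnePoint.infty) :=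
    (h z hz).mono_left (prod_mono le_rfl nhdsWithin_le_nhds)
  rw [nhds_eq_comap_uniformity, tendsto_comap_iff] at h1
  exact h1

/-- Locally uniform escape implies normality: a sequence of iterates either repeats one of them
infinitely often or has exponents tending to infinity. -/
lemma subset_fatouSet_of_escapes {f : ℂ → OnePoint ℂ} {U : Set ℂ} (hU : IsOpen U)
    (hdef : ∀ n, DefinedOn f n U) (h : ∀ z ∈ U, EscapesAt f z) : U ⊆ fatouSet f := by
  refine fun z hz => ⟨U, hU, hz, hdef, fun s => ?_⟩
  rcases tendsto_atTop_or_exists_frequently_eq (fun j => (s j : ℕ)) with hs | ⟨v, hv⟩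
  · exact ⟨id, strictMono_id, _, (tendstoLocallyUniformlyOn_infty h).comp_tendsto hs⟩
  · obtain ⟨φ, hφ, he⟩ := extraction_of_frequently_atTop hv
    refine ⟨φ, hφ, iter f v, ?_⟩
    simp only [he]
    exact tendstoLocallyUniformlyOn_const_seq _ _ _

/-- The Fatou set contains its preimages: normality is pulled back along the map, and one
iterate, the map itself, is added to the family. -/
lemma mem_fatouSet_of_tanVal_mem {c z : ℂ} (h0 : Complex.cos z ≠ 0)
    (hz : tanVal c z ∈ fatouSet (tanMap c)) : z ∈ fatouSet (tanMap c) := by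
  obtain ⟨U, hU, hzU, hdef, hnorm⟩ := hz
  have hcont : ContinuousOn (tanVal c) {z | Complex.cos z ≠ 0} := fun w hw =>
    (differentiableAt_tanVal c hw).continuousAt.continuousWithinAt
  have hsucc : ∀ (n : ℕ) (w : ℂ), Complex.cos w ≠ 0 →
      iter (tanMap c) (n + 1) w = iter (tanMap c) n (tanVal c w) := fun n w hw =>
    iter_succ_of_eq n (tanMap_of_cos_ne_zero hw)
  refine ⟨{z | Complex.cos z ≠ 0} ∩ tanVal c ⁻¹' U,
    hcont.isOpen_inter_preimage isOpen_cos_ne_zero hU, ⟨h0, hzU⟩, ?_, fun s => ?_⟩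
  · rintro n w ⟨hw0, hwU⟩ k -
    cases k with
    | zero => exact OnePoint.coe_ne_infty _
    | succ k =>
      rw [hsucc k w hw0]
      exact hdef (k + 1) _ hwU k k.lt_succ_self
  · by_cases hfr : ∃ᶠ j in atTop, (s j : ℕ) = 1
    · obtain ⟨φ, hφ, he⟩ := extraction_of_frequently_atTop hfr
      refine ⟨φ, hφ, iter (tanMap c) 1, ?_⟩
      simp only [he]
      exact tendstoLocallyUniformlyOn_const_seq _ _ _
    · -- Past the index `N` the shifted exponents `s j - 1` are positive, as normality at
      -- `tanVal c z` requires.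
      obtain ⟨N, hN⟩ := eventually_atTop.1 (not_frequently.1 hfr)
      have hpos : ∀ j, 0 < (s (j + N) : ℕ) - 1 := fun j => by
        have h1 := hN (j + N) (by omega)
        have h2 := (s (j + N)).2
        omega
      obtain ⟨φ, hφ, g, hg⟩ := hnorm fun j => ⟨(s (j + N) : ℕ) - 1, hpos j⟩
      refine ⟨fun j => φ j + N, fun a b hab => Nat.add_lt_add_right (hφ hab) N,
        g ∘ tanVal c, ?_⟩
      refine (hg.comp (tanVal c) (fun w hw => hw.2)
        (hcont.mono inter_subset_left)).congr fun j w hw => ?_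
      have h1 := hpos (φ j)
      have h2 := hsucc ((s (φ j + N) : ℕ) - 1) w hw.1
      rw [Nat.sub_add_cancel (by omega)] at h2
      exact h2.symm

/-- The Fatou set is forward invariant: the map is open, so it carries a neighbourhood on which the
iterates are normal to a neighbourhood of the same kind. -/
lemma tanVal_mem_fatouSet {c z : ℂ} (hz : z ∈ fatouSet (tanMap c)) :
    Complex.cos z ≠ 0 ∧ tanVal c z ∈ fatouSet (tanMap c) := by
  have hcos : ∀ w ∈ fatouSet (tanMap c), Complex.cos w ≠ 0 := fun w hw =>
    tanMap_ne_infty_iff.1 (iter_ne_infty_of_mem_fatouSet hw 1)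
  refine ⟨hcos z hz, ?_⟩
  obtain ⟨U, hU, hzU, hdef, hnorm⟩ := hz
  have hUF : ∀ w ∈ U, Complex.cos w ≠ 0 := fun w hw => hcos w ⟨U, hU, hw, hdef, hnorm⟩
  have hsucc : ∀ (n : ℕ), ∀ w ∈ U,
      iter (tanMap c) (n + 1) w = iter (tanMap c) n (tanVal c w) := fun n w hw =>
    iter_succ_of_eq n (tanMap_of_cos_ne_zero (hUF w hw))
  refine ⟨tanVal c '' U, ?_, mem_image_of_mem _ hzU, ?_, fun s => ?_⟩
  · rw [isOpen_iff_mem_nhds]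
    rintro _ ⟨w, hw, rfl⟩
    exact image_tanVal_mem_nhds c (hUF w hw) (hU.mem_nhds hw)
  · rintro n _ ⟨w, hw, rfl⟩ k -
    rw [← hsucc k w hw]
    exact hdef (k + 2) w hw _ (by omega)
  · obtain ⟨φ, hφ, g, hg⟩ := hnorm fun j => ⟨(s j : ℕ) + 1, Nat.succ_pos _⟩
    -- The limit on `U` is constant on the fibres of the map, so it descends to the image of `U`.
    have hlim : ∀ w ∈ U, Tendsto (fun j => iter (tanMap c) (s (φ j)) (tanVal c w)) atTop
        (𝓝 (g w)) := fun w hw => by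
      have := hg.tendsto_at hw
      simpa only [hsucc _ w hw] using this
    let r : ℂ → ℂ := Function.invFunOn (tanVal c) U
    have hr : ∀ w ∈ U, g (r (tanVal c w)) = g w := fun w hw => by
      have h1 : r (tanVal c w) ∈ U := Function.invFunOn_mem ⟨w, hw, rfl⟩
      have h2 : tanVal c (r (tanVal c w)) = tanVal c w := Function.invFunOn_eq ⟨w, hw, rfl⟩
      have h3 := hlim _ h1
      rw [h2] at h3
      exact tendsto_nhds_unique h3 (hlim w hw)
    refine ⟨φ, hφ, g ∘ r, ?_⟩
    rintro u hu _ ⟨w, hw, rfl⟩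
    obtain ⟨t, ht, hev⟩ := hg u hu w hw
    have ht' : t ∩ U ∈ 𝓝 w :=
      inter_mem ((nhdsWithin_eq_nhds.2 (hU.mem_nhds hw)) ▸ ht) (hU.mem_nhds hw)
    refine ⟨tanVal c '' (t ∩ U), mem_nhdsWithin_of_mem_nhds
      (image_tanVal_mem_nhds c (hUF w hw) ht'), ?_⟩
    filter_upwards [hev] with j hj
    rintro _ ⟨x, hx, rfl⟩
    have h4 := hj x hx.1
    simp only [Function.comp_apply, hr x hx.2]
    rwa [hsucc _ x hx.2] at h4

/-- Where all iterates are defined, they are holomorphic functions with finite values. -/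
lemma exists_differentiable_iter {c : ℂ} {U : Set ℂ} (hdef : ∀ n, DefinedOn (tanMap c) n U)
    (n : ℕ) : ∃ h : ℂ → ℂ, ∀ z ∈ U,
      iter (tanMap c) n z = (h z : OnePoint ℂ) ∧ DifferentiableAt ℂ h z := by
  induction n with
  | zero => exact ⟨id, fun z _ => ⟨rfl, differentiableAt_id⟩⟩
  | succ n ih =>
    obtain ⟨h, hh⟩ := ih
    refine ⟨tanVal c ∘ h, fun z hz => ?_⟩
    have h1 := iter_succ_of_iter_eq (hh z hz).1
    have h2 : Complex.cos (h z) ≠ 0 := by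
      rw [← tanMap_ne_infty_iff (c := c), ← h1]
      exact hdef (n + 2) z hz (n + 1) (by omega)
    exact ⟨h1.trans (tanMap_of_cos_ne_zero h2), (differentiableAt_tanVal c h2).comp z (hh z hz).2⟩

/-! ### Escape to infinity in a half plane -/

lemma exists_norm_bound_of_mem_nhds_infty {N : Set (OnePoint ℂ)}
    (hN : N ∈ 𝓝 (OnePoint.infty : OnePoint ℂ)) :
    ∃ R : ℝ, ∀ w : ℂ, R ≤ ‖w‖ → (w : OnePoint ℂ) ∈ N := by
  have h : ((↑) : ℂ → OnePoint ℂ) ⁻¹' N ∈ coclosedCompact ℂ := by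
    rw [← OnePoint.comap_coe_nhds_infty]
    exact preimage_mem_comap hN
  rw [coclosedCompact_eq_cocompact, ← Metric.cobounded_eq_cocompact, ← comap_norm_atTop,
    (atTop_basis.comap _).mem_iff] at h
  obtain ⟨R, -, hR⟩ := h
  exact ⟨R, fun w hw => hR hw⟩

section HalfPlane

variable {s : ℝ} {c z : ℂ}

lemma le_mul_tanVal_im (hs : s = 1 ∨ s = -1) (hc : 0 ≤ s * c.im) (hz : 0 < s * z.im) :
    s * z.im + s * z.im / (1 + s * z.im) ≤ s * (tanVal c z).im := by
  simp only [tanVal, Complex.add_im]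
  rcases hs with rfl | rfl
  · simp only [one_mul] at *
    linarith [div_one_add_self_le_tan_im hz]
  · have h := div_one_add_self_le_tan_im (z := -z) (by simpa using hz)
    rw [Complex.tan_neg] at h
    simp only [Complex.neg_im, neg_mul, one_mul] at *
    linarith

lemma mul_tanVal_im_le (hs : s = 1 ∨ s = -1) (hz : s * z.im ≤ 0) :
    s * (tanVal c z).im ≤ s * c.im := by
  simp only [tanVal, Complex.add_im]
  rcases hs with rfl | rfl
  · simp only [one_mul] at *
    linarith [tan_im_nonpos hz]
  · have h := tan_im_nonpos (z := -z) (by simpa using hz)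
    rw [Complex.tan_neg] at h
    simp only [Complex.neg_im, neg_mul, one_mul] at *
    linarith

/-- The distance to the real axis grows at least linearly along orbits in an invariant half
plane. -/
lemma exists_iter_eq_of_le_im (hs : s = 1 ∨ s = -1) (hc : 0 ≤ s * c.im) {δ : ℝ} (hδ : 0 < δ)
    (hz : δ ≤ s * z.im) (n : ℕ) :
    ∃ w : ℂ, iter (tanMap c) n z = (w : OnePoint ℂ) ∧ δ + n * (δ / (1 + δ)) ≤ s * w.im := by
  induction n with
  | zero => exact ⟨z, rfl, by simpa using hz⟩
  | succ n ih =>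
    obtain ⟨w, hw, hle⟩ := ih
    have hδw : δ ≤ s * w.im := le_trans (le_add_of_nonneg_right (by positivity)) hle
    have hw0 : 0 < s * w.im := hδ.trans_le hδw
    refine ⟨tanVal c w, (iter_succ_of_iter_eq hw).trans
      (tanMap_of_cos_ne_zero (cos_ne_zero_of_im_ne_zero ?_)), ?_⟩
    · rintro h
      simp [h] at hw0
    · have h1 := le_mul_tanVal_im hs hc hw0
      have h2 : δ / (1 + δ) ≤ s * w.im / (1 + s * w.im) := by
        rw [div_le_div_iff₀ (by positivity) (by positivity)]
        linarith
      push_cast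
      linarith

lemma escapesAt_of_im_pos (hs : s = 1 ∨ s = -1) (hc : 0 ≤ s * c.im) (hz : 0 < s * z.im) :
    EscapesAt (tanMap c) z := by
  intro N hN
  obtain ⟨R, hR⟩ := exists_norm_bound_of_mem_nhds_infty hN
  set δ := s * z.im / 2 with hδ
  have hδ0 : 0 < δ := by positivity
  have h1 : ∀ᶠ w : ℂ in 𝓝 z, δ < s * w.im := by
    refine ContinuousAt.eventually_lt continuousAt_const (by fun_prop) ?_
    linarith
  have h2 : ∀ᶠ n : ℕ in atTop, R ≤ n * (δ / (1 + δ)) :=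
    (tendsto_natCast_atTop_atTop.atTop_mul_const (by positivity)).eventually_ge_atTop R
  rw [mem_map]
  filter_upwards [h2.prod_mk h1]
  rintro ⟨n, w⟩ ⟨hn, hw⟩
  obtain ⟨v, hv, hle⟩ := exists_iter_eq_of_le_im hs hc hδ0 hw.le n
  simp only [mem_preimage, hv]
  refine hR v ?_
  have h3 : s * v.im ≤ |v.im| := by
    rcases hs with rfl | rfl
    · simpa using le_abs_self v.im
    · simpa using neg_le_abs v.im
  simp only at hn
  linarith [Complex.abs_im_le_norm v]

lemma halfPlane_subset_fatouSet (hs : s = 1 ∨ s = -1) (hc : 0 ≤ s * c.im) :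
    {z : ℂ | 0 < s * z.im} ⊆ fatouSet (tanMap c) := by
  refine subset_fatouSet_of_escapes (isOpen_lt continuous_const (by fun_prop)) ?_
    fun z hz => escapesAt_of_im_pos hs hc hz
  intro n z hz k _
  obtain ⟨w, hw, -⟩ := exists_iter_eq_of_le_im hs hc hz le_rfl k
  rw [hw]
  exact OnePoint.coe_ne_infty w

end HalfPlane

/-! ### Propagation of the limit `∞` -/

/-- A continuous map from the sphere to the plane that equals `1 / w` for `1 ≤ ‖w‖` and that
vanishes only at `0` and `∞`. -/
noncomputable def truncInv (w : OnePoint ℂ) : ℂ :=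
  w.elim 0 fun w => (starRingEnd ℂ) w / ((max 1 (‖w‖ ^ 2) : ℝ) : ℂ)

lemma truncInv_infty : truncInv OnePoint.infty = 0 := rfl

lemma truncInv_coe (w : ℂ) :
    truncInv w = (starRingEnd ℂ) w / ((max 1 (‖w‖ ^ 2) : ℝ) : ℂ) := rfl

lemma truncInv_coe_of_one_le {w : ℂ} (h : 1 ≤ ‖w‖) : truncInv w = w⁻¹ := by
  rw [truncInv_coe, max_eq_right (one_le_pow₀ h), Complex.inv_def, Complex.normSq_eq_norm_sq,
    div_eq_mul_inv, Complex.ofReal_inv]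

lemma continuous_truncInv : Continuous truncInv := by
  rw [OnePoint.continuous_iff]
  constructor
  · rw [coclosedCompact_eq_cocompact, truncInv_infty, ← Metric.cobounded_eq_cocompact]
    refine tendsto_inv₀_cobounded.congr' ?_
    filter_upwards [tendsto_norm_cobounded_atTop.eventually_ge_atTop 1] with w hw
    exact (truncInv_coe_of_one_le hw).symm
  · have h : ∀ w : ℂ, ((max 1 (‖w‖ ^ 2) : ℝ) : ℂ) ≠ 0 := fun w =>
      Complex.ofReal_ne_zero.2 (lt_of_lt_of_le one_pos (le_max_left _ _)).ne'
    have : Continuous fun w : ℂ => (starRingEnd ℂ) w / ((max 1 (‖w‖ ^ 2) : ℝ) : ℂ) :=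
      Complex.continuous_conj.div (by fun_prop) h
    exact this

lemma one_lt_norm_mem_nhds_infty :
    {w : OnePoint ℂ | ∀ v : ℂ, w = v → 1 < ‖v‖} ∈ 𝓝 (OnePoint.infty : OnePoint ℂ) := by
  have h : (((↑) : ℂ → OnePoint ℂ) '' Metric.closedBall 0 1)ᶜ ∈
      𝓝 (OnePoint.infty : OnePoint ℂ) :=
    (OnePoint.isOpen_compl_image_coe.2
      ⟨Metric.isClosed_closedBall, isCompact_closedBall 0 1⟩).mem_nhds (by simp)
  filter_upwards [h] with w hw v hv
  by_contra! hle
  exact hw ⟨v, by simpa using hle, hv.symm⟩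

/-- If holomorphic functions converge locally uniformly in the spherical sense, then the interior
of the set where the limit is `∞` is relatively closed: near a boundary point the reciprocal of
the limit is holomorphic. -/
lemma eventually_eq_infty_of_mem_closure {F : ℕ → ℂ → OnePoint ℂ} {g : ℂ → OnePoint ℂ}
    {U : Set ℂ} (hU : IsOpen U) (hF : ∀ n, ∃ h : ℂ → ℂ, ∀ z ∈ U,
      F n z = (h z : OnePoint ℂ) ∧ DifferentiableAt ℂ h z)
    (hg : TendstoLocallyUniformlyOn F g atTop U) {z₀ : ℂ} (hz₀ : z₀ ∈ U)
    (hcl : z₀ ∈ closure {z | ∀ᶠ w in 𝓝 z, g w = OnePoint.infty}) :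
    ∀ᶠ w in 𝓝 z₀, g w = OnePoint.infty := by
  choose h hh using hF
  have hcontF : ∀ n, ContinuousOn (F n) U := fun n =>
    (OnePoint.continuous_coe.comp_continuousOn fun z hz =>
      (hh n z hz).2.continuousAt.continuousWithinAt).congr fun z hz => (hh n z hz).1
  have hgc : ContinuousAt g z₀ :=
    (hg.continuousOn (Frequently.of_forall hcontF)).continuousAt (hU.mem_nhds hz₀)
  by_cases hmem : ∀ᶠ w in 𝓝 z₀, g w = OnePoint.infty
  · exact hmem
  have hfreq : ∃ᶠ z in 𝓝 z₀, ∀ᶠ w in 𝓝 z, g w = OnePoint.infty := mem_closure_iff_frequently.1 hcl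
  have hinf : g z₀ = OnePoint.infty := by
    by_contra hne
    have h1 : ∀ᶠ z in 𝓝 z₀, g z ≠ OnePoint.infty := hgc.eventually_ne hne
    obtain ⟨z, hz, hz'⟩ := (hfreq.and_eventually h1).exists
    exact hz' hz.self_of_nhds
  have hN := one_lt_norm_mem_nhds_infty
  rw [← hinf] at hN
  have htend : Tendsto (fun q : ℕ × ℂ => F q.1 q.2) (atTop ×ˢ 𝓝 z₀) (𝓝 (g z₀)) := by
    have h1 := (hU.tendstoLocallyUniformlyOn_iff_forall_tendsto.1 hg) z₀ hz₀
    exact (hgc.tendsto.comp tendsto_snd).congr_uniformity h1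
  obtain ⟨pa, hpa, pb, hpb, hpq⟩ := eventually_prod_iff.1 (htend hN)
  obtain ⟨J, hJ⟩ := eventually_atTop.1 hpa
  obtain ⟨r, hr, hball⟩ := Metric.mem_nhds_iff.1 (inter_mem hpb (hU.mem_nhds hz₀))
  have hbig : ∀ j, J ≤ j → ∀ z ∈ Metric.ball z₀ r, 1 < ‖h j z‖ := fun j hj z hz =>
    hpq (hJ j hj) (hball hz).1 _ (hh j z (hball hz).2).1
  have huc : UniformContinuous truncInv :=
    CompactSpace.uniformContinuous_of_continuous continuous_truncInv
  have hconv := huc.comp_tendstoLocallyUniformlyOn (hg.mono fun z hz => (hball hz).2)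
  have hdiff : DifferentiableOn ℂ (truncInv ∘ g) (Metric.ball z₀ r) := by
    refine hconv.differentiableOn ?_ Metric.isOpen_ball
    filter_upwards [eventually_ge_atTop J] with j hj
    have h1 : DifferentiableOn ℂ (fun z => (h j z)⁻¹) (Metric.ball z₀ r) := fun z hz =>
      ((hh j z (hball hz).2).2.inv
        (norm_pos_iff.1 (one_pos.trans (hbig j hj z hz)))).differentiableWithinAt
    refine h1.congr fun z hz => ?_
    simp only [Function.comp_apply, (hh j z (hball hz).2).1]
    exact truncInv_coe_of_one_le (hbig j hj z hz).le
  have han : AnalyticAt ℂ (truncInv ∘ g) z₀ := hdiff.analyticAt (Metric.ball_mem_nhds z₀ hr)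
  have hzero : ∀ᶠ z in 𝓝 z₀, (truncInv ∘ g) z = 0 := by
    refine han.eventually_eq_zero_or_eventually_ne_zero.resolve_right fun hne => ?_
    obtain ⟨z, hz, hz'⟩ := (hfreq.and_eventually (eventually_nhdsWithin_iff.1 hne)).exists
    refine hz' (fun he => hmem ?_) ?_
    · rw [mem_singleton_iff.1 he] at hz
      exact hz
    · simp [hz.self_of_nhds, truncInv_infty]
  filter_upwards [hzero, hgc hN] with z h1 h2
  by_contra hne
  obtain ⟨w, hw⟩ := OnePoint.ne_infty_iff_exists.1 hne
  have h3 := h2 w hw.symm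
  rw [Function.comp_apply, ← hw, truncInv_coe_of_one_le h3.le, inv_eq_zero] at h1
  simp [h1] at h3
  linarith

/-! ### Components of the preimage of a disc -/

/-- A connected set of points with values in a fixed disc is bounded: large points of this kind
avoid the lines `re z = k π`, on which `|tan z| ≤ 1`, and the region `1 ≤ |im z|`, in which
`|tan z| ≤ 2`. -/
lemma isBounded_of_isPreconnected_of_tanVal_mem_ball {c w₀ : ℂ} {r : ℝ} {W : Set ℂ}
    (hW : IsPreconnected W) (h : ∀ z ∈ W, tanVal c z ∈ Metric.ball w₀ r) :
    Bornology.IsBounded W := by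
  rcases W.eq_empty_or_nonempty with rfl | ⟨z₀, hz₀⟩
  · exact Bornology.isBounded_empty
  set M := ‖c‖ + ‖w₀‖ + r with hM
  have hle : ∀ z ∈ W, ‖z‖ ≤ M + ‖Complex.tan z‖ := fun z hz => by
    have h1 : ‖tanVal c z - w₀‖ < r := by simpa [dist_eq_norm] using h z hz
    calc ‖z‖ = ‖(tanVal c z - w₀) + w₀ - c - Complex.tan z‖ := by
          congr 1; simp only [tanVal]; ring
      _ ≤ ‖tanVal c z - w₀‖ + ‖w₀‖ + ‖c‖ + ‖Complex.tan z‖ :=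
          (norm_sub_le _ _).trans (add_le_add_left ((norm_sub_le _ _).trans
            (add_le_add_left (norm_add_le _ _) _)) _)
      _ ≤ _ := by linarith
  obtain ⟨k, hk⟩ := exists_nat_gt (max |z₀.re| (M + 1))
  have hkπ : (k : ℝ) ≤ k * Real.pi :=
    le_mul_of_one_le_right k.cast_nonneg (by linarith [Real.pi_gt_three])
  have hk1 := (le_max_left _ _).trans_lt hk
  have hk2 := (le_max_right _ _).trans_lt hk
  have hre : ∀ z ∈ W, |z.re| ≤ k * Real.pi := by
    by_contra! hcon
    obtain ⟨z, hz, hlt⟩ := hcon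
    have hcont : ContinuousOn (fun z : ℂ => |z.re|) W := by fun_prop
    obtain ⟨x, hx, hxk⟩ := hW.intermediate_value hz₀ hz hcont
      ⟨(hk1.trans_le hkπ).le, hlt.le⟩
    have hsin : Real.sin x.re = 0 := by
      rcases abs_choice x.re with h1 | h1 <;> simp only [h1] at hxk
      · rw [hxk, Real.sin_nat_mul_pi]
      · rw [← neg_neg x.re, hxk, Real.sin_neg, Real.sin_nat_mul_pi, neg_zero]
    have h2 := hle x hx
    have h3 := norm_tan_le_one_of_sin_re_eq_zero hsin
    have h4 := Complex.abs_re_le_norm x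
    simp only at hxk
    linarith
  have him : ∀ z ∈ W, |z.im| ≤ max 1 (M + 2) := fun z hz => by
    by_contra! hlt
    have h1 := norm_tan_le_two ((le_max_left _ _).trans hlt.le)
    have h2 := (le_max_right _ _).trans_lt hlt
    linarith [hle z hz, Complex.abs_im_le_norm z]
  refine isBounded_iff_forall_norm_le.2 ⟨k * Real.pi + max 1 (M + 2), fun z hz => ?_⟩
  exact (Complex.norm_le_abs_re_add_abs_im z).trans (add_le_add (hre z hz) (him z hz))

lemma isOpen_tanVal_preimage (c : ℂ) {D : Set ℂ} (hD : IsOpen D) :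
    IsOpen {z | Complex.cos z ≠ 0 ∧ tanVal c z ∈ D} :=
  ContinuousOn.isOpen_inter_preimage (s := {z | Complex.cos z ≠ 0}) (f := tanVal c)
    (fun _ hw => (differentiableAt_tanVal c hw).continuousAt.continuousWithinAt)
    isOpen_cos_ne_zero hD

/-- The map is proper on the components of the preimage of a disc, so each of them is mapped onto
the disc. -/
lemma ball_subset_image_connectedComponentIn {c w₀ z₀ : ℂ} {r : ℝ} (hcos : Complex.cos z₀ ≠ 0)
    (hz₀ : tanVal c z₀ ∈ Metric.ball w₀ r) :
    Metric.ball w₀ r ⊆ tanVal c '' connectedComponentIn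
      {z | Complex.cos z ≠ 0 ∧ tanVal c z ∈ Metric.ball w₀ r} z₀ := by
  set P := {z | Complex.cos z ≠ 0 ∧ tanVal c z ∈ Metric.ball w₀ r} with hP
  set W := connectedComponentIn P z₀ with hW
  have hPo : IsOpen P := isOpen_tanVal_preimage c Metric.isOpen_ball
  have hWo : IsOpen W := hPo.connectedComponentIn
  have hWP : W ⊆ P := connectedComponentIn_subset P z₀
  have hWc : IsPreconnected W := isPreconnected_connectedComponentIn
  have hzW : z₀ ∈ W := mem_connectedComponentIn ⟨hcos, hz₀⟩
  have hbdd := isBounded_of_isPreconnected_of_tanVal_mem_ball hWc fun z hz => (hWP hz).2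
  refine (convex_ball w₀ r).isPreconnected.subset_of_closure_inter_subset ?_
    ⟨_, hz₀, mem_image_of_mem _ hzW⟩ ?_
  · rw [isOpen_iff_mem_nhds]
    rintro _ ⟨z, hz, rfl⟩
    exact image_tanVal_mem_nhds c (hWP hz).1 (hWo.mem_nhds hz)
  · rintro w ⟨hwcl, hwD⟩
    obtain ⟨y, hy, hyw⟩ := mem_closure_iff_seq_limit.1 hwcl
    choose x hx hxy using hy
    obtain ⟨a, ha, φ, hφ, hφa⟩ := tendsto_subseq_of_bounded hbdd hx
    have hlim : Tendsto (fun n => tanVal c (x (φ n))) atTop (𝓝 w) := by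
      simp only [hxy]
      exact hyw.comp hφ.tendsto_atTop
    -- The limit `a` is not a pole, as the values along the sequence stay bounded.
    have hacos : Complex.cos a ≠ 0 := by
      intro h0
      have hid : ∀ n, tanVal c (x (φ n)) * Complex.cos (x (φ n)) =
          (c + x (φ n)) * Complex.cos (x (φ n)) + Complex.sin (x (φ n)) := fun n => by
        have := Complex.tan_mul_cos (hWP (hx (φ n))).1
        simp only [tanVal]
        linear_combination this
      have h1 := hlim.mul ((Complex.continuous_cos.tendsto a).comp hφa)
      have h2 : Tendsto (fun n => (c + x (φ n)) * Complex.cos (x (φ n)) + Complex.sin (x (φ n)))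
          atTop (𝓝 ((c + a) * Complex.cos a + Complex.sin a)) :=
        ((by fun_prop : Continuous fun z : ℂ =>
          (c + z) * Complex.cos z + Complex.sin z).tendsto a).comp hφa
      have h3 := tendsto_nhds_unique (h1.congr hid) h2
      have h4 := Complex.sin_sq_add_cos_sq a
      simp only [h0, mul_zero, zero_add] at h3
      simp [h0, ← h3] at h4
    have haw : tanVal c a = w :=
      tendsto_nhds_unique ((differentiableAt_tanVal c hacos).continuousAt.tendsto.comp hφa) hlim
    have haP : a ∈ P := ⟨hacos, haw ▸ hwD⟩
    have hins : insert a W ⊆ W :=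
      IsPreconnected.subset_connectedComponentIn
        (hWc.subset_closure (subset_insert a W) (insert_subset ha subset_closure))
        (mem_insert_of_mem a hzW) (insert_subset haP hWP)
    exact ⟨a, hins (mem_insert a W), haw⟩

/-! ### Invariance of a Fatou component -/

section Component

variable {c z₀ : ℂ} {B : Set ℂ}

lemma subset_connectedComponentIn_of_mem {F W : Set ℂ} {z z₀ : ℂ} (hW : IsPreconnected W)
    (hWF : W ⊆ F) (hzW : z ∈ W) (hz : z ∈ connectedComponentIn F z₀) :
    W ⊆ connectedComponentIn F z₀ := by
  rw [connectedComponentIn_eq hz]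
  exact hW.subset_connectedComponentIn hzW hWF

/-- A Fatou component that meets its own preimage is mapped into itself. -/
lemma tanVal_mem_component (hz₀ : ∃ z ∈ connectedComponentIn (fatouSet (tanMap c)) z₀,
      tanVal c z ∈ connectedComponentIn (fatouSet (tanMap c)) z₀) {z : ℂ}
    (hz : z ∈ connectedComponentIn (fatouSet (tanMap c)) z₀) :
    tanVal c z ∈ connectedComponentIn (fatouSet (tanMap c)) z₀ := by
  obtain ⟨y, hy, hyB⟩ := hz₀
  have hsub := connectedComponentIn_subset (fatouSet (tanMap c)) z₀
  refine subset_connectedComponentIn_of_mem (isPreconnected_connectedComponentIn.image _ fun w hw =>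
    (differentiableAt_tanVal c (tanVal_mem_fatouSet (hsub hw)).1).continuousAt.continuousWithinAt)
    ?_ (mem_image_of_mem (tanVal c) hy) hyB (mem_image_of_mem _ hz)
  rintro _ ⟨w, hw, rfl⟩
  exact (tanVal_mem_fatouSet (hsub hw)).2

/-- If all preimages of one point of a Fatou component lie in that component, then so do all
preimages of all its points: by surjectivity onto discs, the set of points with this property is
relatively open and closed. -/
lemma mem_component_of_tanVal_mem
    (hw : ∃ w ∈ connectedComponentIn (fatouSet (tanMap c)) z₀, ∀ z, Complex.cos z ≠ 0 →
      tanVal c z = w → z ∈ connectedComponentIn (fatouSet (tanMap c)) z₀)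
    {z : ℂ} (hcos : Complex.cos z ≠ 0)
    (hz : tanVal c z ∈ connectedComponentIn (fatouSet (tanMap c)) z₀) :
    z ∈ connectedComponentIn (fatouSet (tanMap c)) z₀ := by
  set B := connectedComponentIn (fatouSet (tanMap c)) z₀ with hB
  have hBF : B ⊆ fatouSet (tanMap c) := connectedComponentIn_subset _ z₀
  have hBo : IsOpen B := (isOpen_fatouSet _).connectedComponentIn
  let A : Set ℂ := {w | ∀ z, Complex.cos z ≠ 0 → tanVal c z = w → z ∈ B}
  have key : ∀ w₀ r, Metric.ball w₀ r ⊆ B → ∀ w ∈ Metric.ball w₀ r, w ∈ A →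
      Metric.ball w₀ r ⊆ A := by
    rintro w₀ r hrB w hwr hwA v hv x hx rfl
    obtain ⟨y, hy, hyw⟩ := ball_subset_image_connectedComponentIn hx hv hwr
    have hsub := connectedComponentIn_subset
      {z | Complex.cos z ≠ 0 ∧ tanVal c z ∈ Metric.ball w₀ r} x
    exact subset_connectedComponentIn_of_mem isPreconnected_connectedComponentIn
      (fun t ht => mem_fatouSet_of_tanVal_mem (hsub ht).1 (hBF (hrB (hsub ht).2))) hy
      (hwA y (hsub hy).1 hyw) (mem_connectedComponentIn ⟨hx, hv⟩)
  have hBA : B ⊆ interior A := by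
    have hint : ∀ w₀ ∈ B, w₀ ∈ closure A → w₀ ∈ interior A := by
      intro w₀ hw₀ hcl
      obtain ⟨r, hr, hrB⟩ := Metric.isOpen_iff.1 hBo w₀ hw₀
      obtain ⟨w, hwr, hwA⟩ := mem_closure_iff.1 hcl _ Metric.isOpen_ball (Metric.mem_ball_self hr)
      exact mem_interior.2 ⟨_, key w₀ r hrB w hwr hwA, Metric.isOpen_ball, Metric.mem_ball_self hr⟩
    obtain ⟨w, hwB, hwA⟩ := hw
    refine isPreconnected_connectedComponentIn.subset_of_closure_inter_subset isOpen_interior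
      ⟨w, hwB, hint w hwB (subset_closure hwA)⟩ ?_
    rintro v ⟨hv, hvB⟩
    exact hint v hvB (closure_mono interior_subset hv)
  exact interior_subset (hBA hz) z hcos rfl

/-- On a disc on which the iterates are defined and form a normal family, escape near one point
implies escape at every point, since every limit function is `∞` on an open set. -/
lemma escapesAt_of_mem_ball {z₁ : ℂ} {r : ℝ}
    (hdef : ∀ n, DefinedOn (tanMap c) n (Metric.ball z₁ r))
    (hnorm : IsNormalFamilyOn (fun n : {n : ℕ // 0 < n} => iter (tanMap c) n) (Metric.ball z₁ r))
    {e : ℂ} (her : e ∈ Metric.ball z₁ r) (he : ∀ᶠ z in 𝓝 e, EscapesAt (tanMap c) z) {y : ℂ}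
    (hy : y ∈ Metric.ball z₁ r) : EscapesAt (tanMap c) y := by
  refine tendsto_of_subseq_tendsto fun q hq => ?_
  have hq1 : Tendsto (fun j => (q j).1) atTop atTop := tendsto_fst.comp hq
  have hq2 : Tendsto (fun j => (q j).2) atTop (𝓝 y) := tendsto_snd.comp hq
  obtain ⟨φ, hφ, g, hg⟩ := hnorm fun j => ⟨max (q j).1 1, by positivity⟩
  have hF : ∀ j, ∃ h : ℂ → ℂ, ∀ z ∈ Metric.ball z₁ r,
      iter (tanMap c) (max (q (φ j)).1 1) z = (h z : OnePoint ℂ) ∧ DifferentiableAt ℂ h z :=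
    fun j => exists_differentiable_iter hdef _
  have hindex : Tendsto (fun j => max (q (φ j)).1 1) atTop atTop :=
    tendsto_atTop_mono (fun j => le_max_left _ _) (hq1.comp hφ.tendsto_atTop)
  have hge : ∀ᶠ z in 𝓝 e, g z = OnePoint.infty := by
    filter_upwards [he, Metric.isOpen_ball.mem_nhds her] with z hz hzr
    exact tendsto_nhds_unique (hg.tendsto_at hzr) (hz.tendsto.comp hindex)
  have hall : Metric.ball z₁ r ⊆ {z | ∀ᶠ w in 𝓝 z, g w = OnePoint.infty} := by
    refine (convex_ball z₁ r).isPreconnected.subset_of_closure_inter_subset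
      isOpen_setOfPred_eventually_nhds ⟨e, her, hge⟩ ?_
    rintro z ⟨hz, hzr⟩
    exact eventually_eq_infty_of_mem_closure Metric.isOpen_ball hF hg hzr hz
  have hgy : g y = OnePoint.infty := (hall hy).self_of_nhds
  have hgc : ContinuousWithinAt g (Metric.ball z₁ r) y := by
    have : ContinuousAt g y := (continuousAt_const (y := OnePoint.infty)).congr
      ((hall hy).mono fun w hw => hw.symm)
    exact this.continuousWithinAt
  have hq2' : Tendsto (fun j => (q (φ j)).2) atTop (𝓝[Metric.ball z₁ r] y) := by
    rw [nhdsWithin_eq_nhds.2 (Metric.isOpen_ball.mem_nhds hy)]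
    exact hq2.comp hφ.tendsto_atTop
  refine ⟨φ, ?_⟩
  have h1 := hg.tendsto_comp hgc hy hq2'
  rw [hgy] at h1
  refine h1.congr' ?_
  filter_upwards [(hq1.comp hφ.tendsto_atTop).eventually_ge_atTop 1] with j hj
  simp only [Function.comp_apply] at hj
  simp only [max_eq_left hj]

/-- If one point of a Fatou component has a neighbourhood of escaping points, then the whole
component escapes. -/
lemma escapesAt_of_mem_component {e : ℂ}
    (heB : e ∈ connectedComponentIn (fatouSet (tanMap c)) z₀)
    (he : ∀ᶠ z in 𝓝 e, EscapesAt (tanMap c) z) {z : ℂ}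
    (hz : z ∈ connectedComponentIn (fatouSet (tanMap c)) z₀) : EscapesAt (tanMap c) z := by
  suffices h : connectedComponentIn (fatouSet (tanMap c)) z₀ ⊆
      {z | ∀ᶠ w in 𝓝 z, EscapesAt (tanMap c) w} from (h hz).self_of_nhds
  refine isPreconnected_connectedComponentIn.subset_of_closure_inter_subset
    isOpen_setOfPred_eventually_nhds ⟨e, heB, he⟩ ?_
  rintro y ⟨hycl, hyB⟩
  obtain ⟨U, hU, hyU, hdef, hnorm⟩ := connectedComponentIn_subset _ _ hyB
  obtain ⟨r, hr, hrU⟩ := Metric.isOpen_iff.1 hU y hyU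
  obtain ⟨x, hxr, hx⟩ := mem_closure_iff.1 hycl _ Metric.isOpen_ball (Metric.mem_ball_self hr)
  have hnorm' : IsNormalFamilyOn (fun n : {n : ℕ // 0 < n} => iter (tanMap c) n)
      (Metric.ball y r) := fun s => by
    obtain ⟨φ, hφ, g, hg⟩ := hnorm s
    exact ⟨φ, hφ, g, hg.mono hrU⟩
  filter_upwards [Metric.ball_mem_nhds y hr] with v hv
  exact escapesAt_of_mem_ball (fun n w hw => hdef n w (hrU hw)) hnorm' hxr hx hv

lemma completelyInvariant_and_bakerDomain (hB : IsFatouComponent (tanMap c) B)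
    (hfwd : ∀ z ∈ B, tanVal c z ∈ B)
    (hbwd : ∀ z, Complex.cos z ≠ 0 → tanVal c z ∈ B → z ∈ B)
    (hesc : ∀ z ∈ B, EscapesAt (tanMap c) z) :
    IsCompletelyInvariantComponent (tanMap c) B ∧ IsBakerDomain (tanMap c) B := by
  have hBF : B ⊆ fatouSet (tanMap c) := by
    obtain ⟨z, -, rfl⟩ := hB
    exact connectedComponentIn_subset _ z
  have hper : IsPeriodicComponent (tanMap c) B 1 := by
    refine ⟨hB, ⟨one_pos, hB, ?_⟩, fun n hn => hn.1⟩
    rintro _ ⟨z, hz, rfl⟩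
    exact ⟨tanVal c z, hfwd z hz,
      (tanMap_of_cos_ne_zero (tanVal_mem_fatouSet (hBF hz)).1).symm⟩
  refine ⟨⟨hper, ?_⟩, 1, hper, 0, B, ⟨hB, ?_⟩, fun K hK hKB => ?_⟩
  · rintro z ⟨w, hw, hwz⟩
    obtain ⟨h1, rfl⟩ := tanMap_eq_coe_iff.1 hwz.symm
    exact hbwd z h1 hw
  · rintro _ ⟨z, hz, rfl⟩
    exact ⟨z, hz, rfl⟩
  · simp only [mul_one]
    exact (tendstoLocallyUniformlyOn_iff_tendstoUniformlyOn_of_compact hK).1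
      (tendstoLocallyUniformlyOn_infty fun z hz => hesc z (hKB hz))

end Component

/-! ### Real parameters: the real axis is disjoint from the Fatou set -/

lemma two_mul_sub_le_tan {a b r : ℝ} (hab : a ≤ b) (h : ∀ y ∈ Icc a b, Real.cos y ≠ 0) :
    2 * (b - a) ≤ (r + b + Real.tan b) - (r + a + Real.tan a) := by
  have hd : ∀ y ∈ Icc a b,
      HasDerivAt (fun y => r + y + Real.tan y) (1 + 1 / Real.cos y ^ 2) y := fun y hy => by
    exact ((hasDerivAt_id y).const_add r).add (Real.hasDerivAt_tan (h y hy))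
  refine (convex_Icc a b).mul_sub_le_image_sub_of_le_deriv (f := fun y => r + y + Real.tan y)
    (fun y hy => (hd y hy).continuousAt.continuousWithinAt)
    (fun y hy => (hd y (interior_subset hy)).differentiableAt.differentiableWithinAt)
    (fun y hy => ?_) a (left_mem_Icc.2 hab) b (right_mem_Icc.2 hab) hab
  have hy' := h y (interior_subset hy)
  rw [(hd y (interior_subset hy)).deriv]
  have h1 : (1 : ℝ) ≤ 1 / Real.cos y ^ 2 := by
    rw [le_div_iff₀ (by positivity), one_mul]
    exact Real.cos_sq_le_one y
  linarith

lemma exists_cos_eq_zero_of_pi_le {a b : ℝ} (h : a + Real.pi ≤ b) :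
    ∃ y ∈ Icc a b, Real.cos y = 0 := by
  have h1 := Int.le_ceil ((a - Real.pi / 2) / Real.pi)
  have h2 := (Int.ceil_lt_add_one ((a - Real.pi / 2) / Real.pi)).le
  set k := ⌈(a - Real.pi / 2) / Real.pi⌉
  have hpi := Real.pi_pos
  rw [div_le_iff₀ hpi] at h1
  rw [← sub_le_iff_le_add, le_div_iff₀ hpi] at h2
  exact ⟨(2 * k + 1) * Real.pi / 2, ⟨by linarith, by linarith⟩, Real.cos_eq_zero_iff.2 ⟨k, rfl⟩⟩

/-- The map expands the real axis by a factor of at least two, so some iterate of a real interval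
covers a pole, and no real point has a neighbourhood on which all iterates are defined. -/
lemma ofReal_notMem_fatouSet (r x : ℝ) : (x : ℂ) ∉ fatouSet (tanMap r) := by
  rintro ⟨U, hU, hxU, hdef, -⟩
  obtain ⟨ε, hε, hεU⟩ := Metric.isOpen_iff.1 hU _ hxU
  set b := x + ε / 2 with hb
  have hxb : x ≤ b := by linarith
  have hI : ∀ t ∈ Icc x b, (t : ℂ) ∈ U := fun t ht => hεU <| by
    rw [Metric.mem_ball, Complex.dist_of_im_eq (by simp), Real.dist_eq, abs_lt]
    simp only [Complex.ofReal_re]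
    constructor <;> linarith [ht.1, ht.2]
  have hstep : ∀ (n : ℕ) (G : ℝ → ℝ), ContinuousOn G (Icc x b) →
      (∀ t ∈ Icc x b, iter (tanMap r) n (t : ℂ) = ((G t : ℂ) : OnePoint ℂ)) →
      (∀ t ∈ Icc x b, Real.cos (G t) ≠ 0) ∧ ∀ y ∈ Icc (G x) (G b), Real.cos y ≠ 0 := by
    intro n G hG hiter
    have h1 : ∀ t ∈ Icc x b, Real.cos (G t) ≠ 0 := fun t ht => by
      have h2 := hdef (n + 2) _ (hI t ht) (n + 1) (by omega)
      rw [iter_succ_of_iter_eq (hiter t ht), tanMap_ne_infty_iff, ← Complex.ofReal_cos] at h2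
      exact_mod_cast h2
    refine ⟨h1, fun y hy => ?_⟩
    obtain ⟨t, ht, rfl⟩ := intermediate_value_Icc hxb hG hy
    exact h1 t ht
  have hind : ∀ n : ℕ, ∃ G : ℝ → ℝ, ContinuousOn G (Icc x b) ∧
      (∀ t ∈ Icc x b, iter (tanMap r) n (t : ℂ) = ((G t : ℂ) : OnePoint ℂ)) ∧
      2 ^ n * (b - x) ≤ G b - G x := by
    intro n
    induction n with
    | zero => exact ⟨id, continuousOn_id, fun t _ => rfl, by simp⟩
    | succ n ih =>
      obtain ⟨G, hG, hiter, hlen⟩ := ih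
      obtain ⟨h1, h2⟩ := hstep n G hG hiter
      have h0 : (0 : ℝ) ≤ 2 ^ n * (b - x) := mul_nonneg (by positivity) (by linarith)
      refine ⟨fun t => r + G t + Real.tan (G t), ?_, fun t ht => ?_, ?_⟩
      · exact (continuousOn_const.add hG).add fun t ht =>
          (Real.continuousAt_tan.2 (h1 t ht)).comp_continuousWithinAt (hG t ht)
      · have hc : Complex.cos (G t : ℂ) ≠ 0 := by
          rw [← Complex.ofReal_cos]
          exact_mod_cast h1 t ht
        rw [iter_succ_of_iter_eq (hiter t ht), tanMap_of_cos_ne_zero hc, tanVal]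
        push_cast
        rfl
      · have h3 := two_mul_sub_le_tan (r := r) (by linarith : G x ≤ G b) h2
        rw [pow_succ]
        linarith
  obtain ⟨n, hn⟩ := pow_unbounded_of_one_lt (Real.pi / (b - x)) (one_lt_two (α := ℝ))
  obtain ⟨G, hG, hiter, hlen⟩ := hind n
  rw [div_lt_iff₀ (by linarith)] at hn
  obtain ⟨y, hy, hy0⟩ := exists_cos_eq_zero_of_pi_le (by linarith : G x + Real.pi ≤ G b)
  exact (hstep n G hG hiter).2 y hy hy0

lemma fatouSet_ofReal (r : ℝ) :
    fatouSet (tanMap r) = {z : ℂ | 0 < z.im} ∪ {z : ℂ | z.im < 0} := by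
  refine Subset.antisymm (fun z hz => ?_) (union_subset ?_ ?_)
  · rcases lt_trichotomy z.im 0 with h | h | h
    · exact Or.inr h
    · exact absurd ((Complex.ext rfl (by simp [h]) : ((z.re : ℝ) : ℂ) = z) ▸ hz)
        (ofReal_notMem_fatouSet r z.re)
    · exact Or.inl h
  · have := halfPlane_subset_fatouSet (s := 1) (c := r) (Or.inl rfl) (by simp)
    simpa using this
  · have := halfPlane_subset_fatouSet (s := -1) (c := r) (Or.inr rfl) (by simp)
    simpa using this

lemma isFatouComponent_halfPlane (r : ℝ) {s : ℝ} (hs : s = 1 ∨ s = -1) :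
    IsFatouComponent (tanMap r) {z : ℂ | 0 < s * z.im} := by
  have hss : s * s = 1 := by rcases hs with rfl | rfl <;> norm_num
  have hF : fatouSet (tanMap r) = {z : ℂ | 0 < s * z.im} ∪ {z : ℂ | s * z.im < 0} := by
    rw [fatouSet_ofReal]
    rcases hs with rfl | rfl
    · simp
    · simp [union_comm]
  have hI : (s * Complex.I : ℂ) ∈ {z : ℂ | 0 < s * z.im} := by simp [hss]
  have hIF := halfPlane_subset_fatouSet (c := r) hs (by simp) hI
  have hconv : Convex ℝ {z : ℂ | 0 < s * z.im} :=
    convex_halfSpace_gt (s • Complex.imLm).isLinear 0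
  refine ⟨s * Complex.I, hIF, Subset.antisymm
    (hconv.isPreconnected.subset_connectedComponentIn hI
      (halfPlane_subset_fatouSet hs (by simp))) ?_⟩
  have hcont : Continuous fun z : ℂ => s * z.im := by fun_prop
  refine isPreconnected_connectedComponentIn.subset_left_of_subset_union
    (isOpen_lt continuous_const hcont) (isOpen_lt hcont continuous_const)
    (Set.disjoint_left.2 fun z (h1 : 0 < s * z.im) h2 => lt_asymm h1 h2) ?_ ⟨_, mem_connectedComponentIn hIF, hI⟩
  rw [← hF]
  exact connectedComponentIn_subset _ _

lemma halfPlane_completelyInvariant_and_bakerDomain (r : ℝ) {s : ℝ} (hs : s = 1 ∨ s = -1) :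
    IsCompletelyInvariantComponent (tanMap r) {z : ℂ | 0 < s * z.im} ∧
      IsBakerDomain (tanMap r) {z : ℂ | 0 < s * z.im} := by
  refine completelyInvariant_and_bakerDomain (isFatouComponent_halfPlane r hs) ?_ ?_
    fun z hz => escapesAt_of_im_pos hs (by simp) hz
  · intro z hz
    have hz' : 0 < s * z.im := hz
    have := le_mul_tanVal_im (c := r) hs (by simp) hz'
    exact hz'.trans_le ((le_add_of_nonneg_right (by positivity)).trans this)
  · intro z _ hz
    by_contra hle
    have := mul_tanVal_im_le (c := r) hs (not_lt.1 hle)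
    rw [Complex.ofReal_im, mul_zero] at this
    exact this.not_gt hz

/-! ### The primary component for parameters in the upper half plane -/

lemma exists_primary_component {c : ℂ} (hc : 0 < c.im) :
    ∃ B : Set ℂ, IsCompletelyInvariantComponent (tanMap c) B ∧
      IsBakerDomain (tanMap c) B ∧ {z : ℂ | 0 < z.im} ⊆ B := by
  have hc' : 0 ≤ 1 * c.im := by linarith
  have hHF : {z : ℂ | 0 < z.im} ⊆ fatouSet (tanMap c) := by
    simpa using halfPlane_subset_fatouSet (Or.inl rfl) hc'
  have hesc : ∀ z : ℂ, 0 < z.im → EscapesAt (tanMap c) z := fun z hz =>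
    escapesAt_of_im_pos (Or.inl rfl) hc' (by simpa using hz)
  have hHo : IsOpen {z : ℂ | 0 < z.im} := isOpen_lt continuous_const Complex.continuous_im
  have hI : Complex.I ∈ {z : ℂ | 0 < z.im} := by simp
  have hHB : {z : ℂ | 0 < z.im} ⊆ connectedComponentIn (fatouSet (tanMap c)) Complex.I :=
    (convex_halfSpace_im_gt 0).isPreconnected.subset_connectedComponentIn hI hHF
  refine ⟨connectedComponentIn (fatouSet (tanMap c)) Complex.I, ?_⟩
  rw [← and_assoc]
  refine ⟨completelyInvariant_and_bakerDomain ⟨_, hHF hI, rfl⟩ (fun z hz => ?_)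
    (fun z hcos hz => ?_) fun z hz => ?_, hHB⟩
  · refine tanVal_mem_component ⟨Complex.I, hHB hI, hHB ?_⟩ hz
    have := le_mul_tanVal_im (z := Complex.I) (Or.inl rfl) hc' (by simp)
    norm_num at this
    exact lt_of_lt_of_le (by norm_num) this
  · -- Points of the closed lower half plane have images of imaginary part at most `im c`, so all
    -- preimages of `2 c` lie in the upper half plane.
    refine mem_component_of_tanVal_mem ⟨2 * c, hHB (by simpa using hc), fun y _ hy => hHB ?_⟩
      hcos hz
    by_contra hle
    have h1 := mul_tanVal_im_le (s := 1) (c := c) (z := y) (Or.inl rfl)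
      (by simpa using hle)
    rw [hy] at h1
    simp at h1
    linarith
  · exact escapesAt_of_mem_component (hHB hI) (mem_of_superset (hHo.mem_nhds hI) hesc) hz

end MeroDynamics

theorem mainTheorem1 :
    (∀ c : ℂ, 0 < c.im →
      ∃ B : Set ℂ, MeroDynamics.IsCompletelyInvariantComponent (MeroDynamics.tanMap c) B ∧
        MeroDynamics.IsBakerDomain (MeroDynamics.tanMap c) B ∧
        {z : ℂ | 0 < z.im} ⊆ B) ∧
    (∀ r : ℝ,
      (MeroDynamics.IsCompletelyInvariantComponent
          (MeroDynamics.tanMap (r : ℂ)) {z : ℂ | 0 < z.im} ∧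
        MeroDynamics.IsBakerDomain (MeroDynamics.tanMap (r : ℂ)) {z : ℂ | 0 < z.im}) ∧
      (MeroDynamics.IsCompletelyInvariantComponent
          (MeroDynamics.tanMap (r : ℂ)) {z : ℂ | z.im < 0} ∧
        MeroDynamics.IsBakerDomain (MeroDynamics.tanMap (r : ℂ)) {z : ℂ | z.im < 0}) ∧
      MeroDynamics.fatouSet (MeroDynamics.tanMap (r : ℂ)) =
        {z : ℂ | 0 < z.im} ∪ {z : ℂ | z.im < 0}) := by
  refine ⟨fun c hc => MeroDynamics.exists_primary_component hc, fun r => ⟨?_, ?_,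
    MeroDynamics.fatouSet_ofReal r⟩⟩
  · simpa using MeroDynamics.halfPlane_completelyInvariant_and_bakerDomain r (Or.inl rfl)
  · simpa using MeroDynamics.halfPlane_completelyInvariant_and_bakerDomain r (Or.inr rfl)
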